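/- Let $k\ge 1$ be a fixed integer. For each $n$ let $P_n$ be a non-negative integer and $p_n\in[0,1]$. The binomial random intersection graph $G_b(n,P_n,p_n)$ has node set $\{v_1,\dots,v_n\}$; each node $v_i$ is assigned a random subset $S_i$ of a fixed pool of $P_n$ objects, each object being put into each $S_i$ with probability $p_n$, independently over all objects and all nodes; two distinct nodes $v_i,v_j$ are adjacent if and only if $S_i\cap S_j\neq\emptyset$. A graph with node set $\mathcal V$ is called $k$-robust if for every pair of non-empty disjoint subsets $A,B\subseteq\mathcal V$, either some node of $A$ has at least $k$ neighbors in $\mathcal V\setminus A$, or some node of $B$ has at least $k$ neighbors in $\mathcal V\setminus B$ (or both). Let the real sequence $(\alpha_n)$ be defined through $$p_n^2P_n=\frac{\ln n+(k-1)\ln\ln n+\alpha_n}{n}\qquad (n\ge 2),$$ and suppose that $P_n=\Omega\big(n(\ln n)^5\big)$, i.e. there is a constant $c>0$ such that $P_n\ge c\,n(\ln n)^5$ for all sufficiently large $n$. Then $$\lim_{n\to\infty}\mathbb P\big[G_b(n,P_n,p_n)\text{ is }k\text{-robust}\big]=\begin{cases}0,&\text{if }\lim_{n\to\infty}\alpha_n=-\infty,\\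 1,&\text{if }\lim_{n\to\infty}\alpha_n=\infty.\end{cases}$$ -/

import Mathlib

open Filter Topology MeasureTheory ProbabilityTheory

/-- The intersection graph of a family `S` of object sets: two distinct nodes are adjacent if and
only if their object sets share at least one object. -/
def intersectionGraph {V O : Type*} (S : V → Set O) : SimpleGraph V where
  Adj u v := u ≠ v ∧ (S u ∩ S v).Nonempty
  symm := ⟨fun u v h => ⟨h.1.symm, Set.inter_comm (S u) (S v) ▸ h.2⟩⟩
  loopless := ⟨fun _ h => h.1 rfl⟩

/-- A graph is `k`-robust if, for every pair of non-empty disjoint node sets `A`, `B`, some node of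
`A` has at least `k` neighbours outside `A`, or some node of `B` has at least `k` neighbours
outside `B`. -/
def IsKRobust {V : Type*} (G : SimpleGraph V) (k : ℕ) : Prop :=
  ∀ A B : Set V, A.Nonempty → B.Nonempty → Disjoint A B →
    (∃ a ∈ A, (k : ℕ∞) ≤ (G.neighborSet a \ A).encard) ∨
    (∃ b ∈ B, (k : ℕ∞) ≤ (G.neighborSet b \ B).encard)

/-- The law of the object sets in the binomial model: `n` nodes choose independent random subsets of
a pool of `P` objects, and each object belongs to each set independently with probability `p`. -/
noncomputable def binomialObjectSets (n P : ℕ) (p : unitInterval) :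
    Measure (Fin n → Set (Fin P)) :=
  Measure.pi fun _ => setBernoulli (Set.univ : Set (Fin P)) p

/-- The probability that the binomial random intersection graph with `n` nodes, `P` objects and
attachment probability `p` is `k`-robust. -/
noncomputable def probKRobust (n P : ℕ) (p : unitInterval) (k : ℕ) : ℝ :=
  (binomialObjectSets n P p).real {S | IsKRobust (intersectionGraph S) k}

/-!
Let `T o` be the set of nodes holding object `o`. These are `P` independent `p`-random sets of
nodes (`binomialObjectSets_map_transpose`), and
`B = n * p ^ 2 * P = log n + (k - 1) * log (log n) + α` is roughly the mean degree. Robustness is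
an increasing property and the law is monotone in `p` (`probKRobust_mono`, by thinning), so one may
assume `|α| ≤ log (log n)` in the relevant direction. Then the size of the pool forces
`n * p = o(1 / log n)` (`exists_attachment`): objects held by three or more nodes are rare enough
not to matter.

*Case `α → ∞`.* Of two disjoint sets violating robustness one, `A`, has `a ≤ n / 2` nodes, and at
most `(k - 1) * a` of the `a * (n - a)` pairs leaving `A` are of the form `T o`. The generating
function of the number of such pairs is dominated by the one for independent pairs
(`integral_pow_card_hit_le`), and Markov's inequality at `z = 1 / log n` bounds the probability by
`((log n) ^ (k - 1) * C * exp (-B * (n - a) / n)) ^ a`. As there are at most `(e * n / a) ^ a` sets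
`A`, and `exp (B * a / n) = O(a)` for `a ≤ n / 2`, the union bound is a geometric series with ratio
`C' * exp (-α)` (`one_sub_probKRobust_le_exp`).

*Case `α → -∞`.* A node of degree less than `k` destroys robustness. The events
`lowDegreeEvent (v, J)` say that exactly the objects in `J`, `#J = k - 1`, give `v` a neighbour,
each of them a single one in the second half of the nodes, where `v` is in the first half. They are
boxes in the product space, so their probabilities and those of their intersections are explicit
products. The expected number of them that occur is at least a constant times `exp (-α)`, while
events for distinct `v` are asymptotically uncorrelated, and the second moment method applies
(`probKRobust_le_exp`).
-/

/-! ### Thinning and monotonicity in the attachment probability -/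

/-- If `f` pushes `μ ⊗ ν` to `ρ`, then applying `f` coordinatewise pushes the product of the powers
of `μ` and `ν` to the power of `ρ`. It is used at two levels: for the objects within one random set
and for the nodes. -/
theorem pi_prod_map {ι X Y Z : Type*} [Fintype ι] [MeasurableSpace X] [MeasurableSpace Y]
    [MeasurableSpace Z] (μ : Measure X) (ν : Measure Y) (ρ : Measure Z) [IsProbabilityMeasure μ]
    [IsProbabilityMeasure ν] (f : X × Y → Z) (hf : Measurable f)
    (h : (μ.prod ν).map f = ρ) :
    ((Measure.pi fun _ : ι => μ).prod (Measure.pi fun _ : ι => ν)).map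
      (fun w i => f (w.1 i, w.2 i)) = Measure.pi fun _ : ι => ρ := by
  have : IsProbabilityMeasure ρ := h ▸ Measure.isProbabilityMeasure_map hf.aemeasurable
  rw [← (measurePreserving_arrowProdEquivProdArrow X Y ι (fun _ => μ) (fun _ => ν)).map_eq,
    Measure.map_map (by fun_prop) (MeasurableEquiv.measurable _)]
  subst h
  exact Measure.pi_map_pi (μ := fun _ : ι => μ.prod ν) (f := fun _ => f) (fun _ => hf.aemeasurable)

/-- Thinning: the intersection of independent `p`- and `q`-random subsets is a `p * q`-random
subset. -/
theorem setBernoulli_prod_map_inter {ι : Type*} [Fintype ι] (p q : unitInterval) :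
    ((setBernoulli (Set.univ : Set ι) p).prod (setBernoulli (Set.univ : Set ι) q)).map
      (fun w => w.1 ∩ w.2) = setBernoulli Set.univ (p * q) := by
  have key := pi_prod_map (ι := ι)
    (unitInterval.toNNReal p • Measure.dirac True +
      unitInterval.toNNReal (unitInterval.symm p) • Measure.dirac False)
    (unitInterval.toNNReal q • Measure.dirac True +
      unitInterval.toNNReal (unitInterval.symm q) • Measure.dirac False)
    (unitInterval.toNNReal (p * q) • Measure.dirac True +
      unitInterval.toNNReal (unitInterval.symm (p * q)) • Measure.dirac False)
    (fun w => w.1 ∧ w.2) (by fun_prop) (by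
      have htrue : ∀ r : unitInterval, (unitInterval.toNNReal r • Measure.dirac True +
          unitInterval.toNNReal (unitInterval.symm r) • Measure.dirac False) {True} =
          (unitInterval.toNNReal r : ENNReal) := by
        intro r
        simp
      have hpre : (fun w : Prop × Prop => w.1 ∧ w.2) ⁻¹' {True} = {True} ×ˢ {True} := by
        ext w
        simp [Prod.ext_iff]
      have : IsProbabilityMeasure (Measure.map (fun w : Prop × Prop => w.1 ∧ w.2)
          ((unitInterval.toNNReal p • Measure.dirac True +
            unitInterval.toNNReal (unitInterval.symm p) • Measure.dirac False).prod
          (unitInterval.toNNReal q • Measure.dirac True +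
            unitInterval.toNNReal (unitInterval.symm q) • Measure.dirac False))) :=
        Measure.isProbabilityMeasure_map (by fun_prop)
      have hT : Measure.map (fun w : Prop × Prop => w.1 ∧ w.2)
          ((unitInterval.toNNReal p • Measure.dirac True +
            unitInterval.toNNReal (unitInterval.symm p) • Measure.dirac False).prod
          (unitInterval.toNNReal q • Measure.dirac True +
            unitInterval.toNNReal (unitInterval.symm q) • Measure.dirac False)) {True} =
          (unitInterval.toNNReal (p * q) • Measure.dirac True +
            unitInterval.toNNReal (unitInterval.symm (p * q)) • Measure.dirac False) {True} := by
        rw [Measure.map_apply (by fun_prop) .of_discrete, hpre, Measure.prod_prod, htrue, htrue,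
          htrue, ← ENNReal.coe_mul]
        congr 1
      refine Measure.ext_of_singleton fun a => ?_
      by_cases ha : a
      · simpa only [ha] using hT
      · have hF : ({a} : Set Prop) = {True}ᶜ := by
          ext b
          simp [ha]
        rw [hF, prob_compl_eq_one_sub .of_discrete, prob_compl_eq_one_sub .of_discrete, hT])
  rw [setBernoulli_eq_map, setBernoulli_eq_map, setBernoulli_eq_map]
  simp only [Set.mem_univ, Measure.infinitePi_eq_pi]
  rw [← key, Measure.map_prod_map _ _ (by fun_prop) (by fun_prop),
    Measure.map_map (by fun_prop) (by fun_prop), Measure.map_map (by fun_prop) (by fun_prop)]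
  rfl

/-- The probability of an increasing event is monotone in the attachment probability: writing
`p = q * r`, a family with parameter `p` is a thinning of one with parameter `q`. -/
theorem binomialObjectSets_real_mono {n P : ℕ} {p q : unitInterval} (hpq : p ≤ q)
    {E : Set (Fin n → Set (Fin P))} (hE : ∀ S S', S ∈ E → (∀ i, S i ⊆ S' i) → S' ∈ E) :
    (binomialObjectSets n P p).real E ≤ (binomialObjectSets n P q).real E := by
  obtain ⟨r, rfl⟩ : ∃ r : unitInterval, p = q * r := by
    rcases eq_or_ne q 0 with rfl | hq
    · exact ⟨0, le_antisymm (by simpa using hpq) (by simp)⟩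
    · have hq' : (0 : ℝ) < q := lt_of_le_of_ne q.2.1 (fun h => hq (Subtype.ext h.symm))
      refine ⟨⟨p / q, div_nonneg p.2.1 q.2.1, div_le_one_of_le₀ hpq q.2.1⟩, Subtype.ext ?_⟩
      exact (mul_div_cancel₀ _ hq'.ne').symm
  unfold binomialObjectSets
  rw [← pi_prod_map (ι := Fin n) _ _ _ _ (by fun_prop)
    (setBernoulli_prod_map_inter (ι := Fin P) q r),
    map_measureReal_apply (by fun_prop) .of_discrete]
  calc _ ≤ ((Measure.pi fun _ : Fin n => setBernoulli (Set.univ : Set (Fin P)) q).prod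
        (Measure.pi fun _ : Fin n => setBernoulli (Set.univ : Set (Fin P)) r)).real
          (E ×ˢ Set.univ) := by
        refine measureReal_mono ?_
        rintro ⟨S, T⟩ h
        exact ⟨hE _ _ h fun i => Set.inter_subset_left, trivial⟩
    _ = _ := by rw [measureReal_prod_prod]; simp

/-! ### The node sets of the objects -/

/-- Seen from the objects, the model consists of `P` independent `p`-random sets of nodes: object
`o` selects the set `T o` of the nodes that hold it. -/
theorem binomialObjectSets_map_transpose (n P : ℕ) (p : unitInterval) :
    (binomialObjectSets n P p).map (fun S o => {i | o ∈ S i}) =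
      Measure.pi fun _ : Fin P => setBernoulli (Set.univ : Set (Fin n)) p := by
  classical
  refine Measure.ext_of_singleton fun T => ?_
  rw [Measure.map_apply .of_discrete .of_discrete]
  have : (fun (S : Fin n → Set (Fin P)) (o : Fin P) => {i | o ∈ S i}) ⁻¹' {T} =
      {fun i => {o | i ∈ T o}} := by
    ext S
    simp only [Set.mem_preimage, Set.mem_singleton_iff, funext_iff, Set.ext_iff, Set.mem_ofPred_eq]
    exact forall_comm
  have hs (m : ℕ) (s : Set (Fin m)) : setBernoulli (Set.univ : Set (Fin m)) p {s} =
      ∏ i, if i ∈ s then (unitInterval.toNNReal p : ENNReal)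
        else unitInterval.toNNReal (unitInterval.symm p) := by
    rw [setBernoulli_singleton _ (Set.subset_univ _) Set.finite_univ, Finset.prod_ite]
    simp only [Finset.prod_const]
    congr 2
    · rw [Set.ncard_eq_toFinset_card']
      congr 1
      ext
      simp
    · rw [Set.ncard_eq_toFinset_card']
      congr 1
      ext
      simp
  rw [this, binomialObjectSets, Measure.pi_singleton, Measure.pi_singleton]
  simp only [hs]
  exact Finset.prod_comm

theorem setBernoulli_real_superset {ι : Type*} [Fintype ι] (p : unitInterval) (A : Finset ι) :
    (setBernoulli (Set.univ : Set ι) p).real {T | ↑A ⊆ T} = (p : ℝ) ^ A.card := by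
  rw [measureReal_def, setBernoulli_apply']
  have : (fun p : ι → Prop => {i | p i}) ⁻¹' {T | ↑A ⊆ T} = Set.pi (A : Set ι) fun _ => {True} := by
    ext f
    simp [Set.subset_def]
  rw [this, Measure.infinitePi_pi _ (by measurability)]
  simp

theorem IsKRobust.mono {V : Type*} {G H : SimpleGraph V} {k : ℕ} (h : G ≤ H) (hG : IsKRobust G k) :
    IsKRobust H k := by
  intro A B hA hB hAB
  refine (hG A B hA hB hAB).imp ?_ ?_ <;>
  · rintro ⟨a, ha, hk⟩
    exact ⟨a, ha, hk.trans (Set.encard_le_encard (Set.sdiff_subset_sdiff_left fun b hb => h hb))⟩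

theorem intersectionGraph_mono {V O : Type*} {S S' : V → Set O} (h : ∀ i, S i ⊆ S' i) :
    intersectionGraph S ≤ intersectionGraph S' :=
  fun u v huv => ⟨huv.1, huv.2.mono (Set.inter_subset_inter (h u) (h v))⟩

theorem probKRobust_mono {n P k : ℕ} {p q : unitInterval} (hpq : p ≤ q) :
    probKRobust n P p k ≤ probKRobust n P q k :=
  binomialObjectSets_real_mono hpq fun _ _ hS h => IsKRobust.mono (intersectionGraph_mono h) hS

/-- The probability of `k`-robustness in terms of the independent node sets `T o` of the objects. -/
theorem probKRobust_eq (n P : ℕ) (p : unitInterval) (k : ℕ) :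
    probKRobust n P p k = (Measure.pi fun _ : Fin P => setBernoulli (Set.univ : Set (Fin n)) p).real
      {T | IsKRobust (intersectionGraph fun i => {o | i ∈ T o}) k} := by
  rw [← binomialObjectSets_map_transpose, map_measureReal_apply .of_discrete .of_discrete]
  rfl

/-! ### The number of values hit by independent draws -/

/-- Among `P` independent draws, each taking every value of `W` with probability `τ`, the chance
that no draw lands in `W` is at most what it would be if the values were hit independently at rate
`P * τ`. -/
theorem pi_real_forall_notMem_le {Ω : Type*} [Fintype Ω] [MeasurableSpace Ω]
    [DiscreteMeasurableSpace Ω] (ν : Measure Ω) [IsProbabilityMeasure ν] (P : ℕ) (W : Finset Ω)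
    {τ : ℝ} (hW : ∀ e ∈ W, ν.real {e} = τ) :
    (Measure.pi fun _ : Fin P => ν).real {T | ∀ o, T o ∉ W} ≤ Real.exp (-(P * τ)) ^ W.card := by
  have hset : {T : Fin P → Ω | ∀ o, T o ∉ W} = Set.pi Set.univ fun _ => (W : Set Ω)ᶜ := by
    ext T
    simp
  have hν : ν.real (W : Set Ω) = W.card * τ := by
    rw [← sum_measureReal_singleton, Finset.sum_congr rfl hW]
    simp
  have hc : ν.real (W : Set Ω)ᶜ = 1 - W.card * τ := by
    rw [measureReal_compl .of_discrete, hν]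
    simp
  rw [hset, measureReal_def, Measure.pi_pi, Finset.prod_const, ENNReal.toReal_pow,
    ← measureReal_def, hc, Finset.card_univ, Fintype.card_fin]
  calc (1 - W.card * τ) ^ P ≤ Real.exp (-(W.card * τ)) ^ P := by
        refine pow_le_pow_left₀ (hc ▸ measureReal_nonneg) ?_ _
        linarith [Real.add_one_le_exp (-(W.card * τ))]
    _ = Real.exp (-(P * τ)) ^ W.card := by
        rw [← Real.exp_nat_mul, ← Real.exp_nat_mul]
        ring_nf

open Classical in
/-- Probability generating function of the number of values in `E` that are hit by `P` independent
draws. The hits of distinct values are dependent, but expanding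
`z ^ #hits = ∏ (z + (1 - z) * 1[not hit])` only involves probabilities that a set of values is
missed, for which `pi_real_forall_notMem_le` gives the bound of the independent case. -/
theorem integral_pow_card_hit_le {Ω : Type*} [Fintype Ω] [MeasurableSpace Ω]
    [DiscreteMeasurableSpace Ω] (ν : Measure Ω) [IsProbabilityMeasure ν] (P : ℕ) (E : Finset Ω)
    {τ z : ℝ} (hE : ∀ e ∈ E, ν.real {e} = τ) (hz : 0 ≤ z) (hz1 : z ≤ 1) :
    ∫ T, z ^ (E.filter fun e => ∃ o, T o = e).card ∂(Measure.pi fun _ : Fin P => ν) ≤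
      ((1 - z) * Real.exp (-(P * τ)) + z) ^ E.card := by
  have hexp (T : Fin P → Ω) : z ^ (E.filter fun e => ∃ o, T o = e).card =
      ∑ W ∈ E.powerset, (1 - z) ^ W.card * z ^ (E.card - W.card) *
        {T : Fin P → Ω | ∀ o, T o ∉ W}.indicator (fun _ => (1 : ℝ)) T := by
    calc z ^ (E.filter fun e => ∃ o, T o = e).card
        = ∏ e ∈ E, ((if ∀ o, T o ≠ e then 1 - z else 0) + z) := by
          rw [← Finset.prod_const, Finset.prod_filter]
          refine Finset.prod_congr rfl fun e _ => ?_
          by_cases h : ∃ o, T o = e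
          · simp [h]
          · simp [not_exists.1 h]
      _ = ∑ W ∈ E.powerset, (∏ e ∈ W, if ∀ o, T o ≠ e then 1 - z else 0) * ∏ e ∈ E \ W, z :=
          Finset.prod_add _ _ _
      _ = _ := by
          refine Finset.sum_congr rfl fun W hW => ?_
          rw [Finset.prod_const, Finset.card_sdiff_of_subset (Finset.mem_powerset.1 hW)]
          by_cases h : ∀ o, T o ∉ W
          · rw [Set.indicator_of_mem (by exact h), mul_one, ← Finset.prod_const]
            congr 1
            exact Finset.prod_congr rfl fun e he => if_pos fun o ho => h o (by rwa [ho])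
          · rw [Set.indicator_of_notMem (by exact h)]
            push Not at h
            obtain ⟨o, ho⟩ := h
            rw [Finset.prod_eq_zero ho, zero_mul, mul_zero]
            exact if_neg fun h => h o rfl
  simp_rw [hexp]
  rw [integral_finsetSum _ fun _ _ => .of_finite, ← Finset.sum_pow_mul_eq_add_pow]
  refine Finset.sum_le_sum fun W hW => ?_
  rw [integral_const_mul, integral_indicator_const _ .of_discrete, smul_eq_mul, mul_one, mul_pow,
    mul_right_comm]
  have h1 : 0 ≤ 1 - z := by linarith
  gcongr
  exact pi_real_forall_notMem_le ν P W fun e he => hE e (Finset.mem_powerset.1 hW he)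

open Classical in
/-- Chernoff bound: at most `K` of the values in `E` are hit. -/
theorem pi_real_card_hit_le {Ω : Type*} [Fintype Ω] [MeasurableSpace Ω]
    [DiscreteMeasurableSpace Ω] (ν : Measure Ω) [IsProbabilityMeasure ν] (P : ℕ) (E : Finset Ω)
    {τ z : ℝ} (hE : ∀ e ∈ E, ν.real {e} = τ) (hz : 0 < z) (hz1 : z ≤ 1) (K : ℕ) :
    (Measure.pi fun _ : Fin P => ν).real {T | (E.filter fun e => ∃ o, T o = e).card ≤ K} ≤
      z⁻¹ ^ K * Real.exp (-((1 - z) * (1 - Real.exp (-(P * τ))))) ^ E.card := by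
  have h1 : 0 ≤ 1 - z := by linarith
  have hbase : (1 - z) * Real.exp (-(P * τ)) + z ≤
      Real.exp (-((1 - z) * (1 - Real.exp (-(P * τ))))) := by
    linarith [Real.add_one_le_exp (-((1 - z) * (1 - Real.exp (-(P * τ)))))]
  have hmk := (mul_meas_ge_le_integral_of_nonneg (μ := Measure.pi fun _ : Fin P => ν)
    (f := fun T => z ^ (E.filter fun e => ∃ o, T o = e).card)
    (.of_forall fun T => by positivity) .of_finite (z ^ K)).trans
    (integral_pow_card_hit_le ν P E hE hz.le hz1)
  have hmk2 : z ^ K * (Measure.pi fun _ : Fin P => ν).real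
      {T | (E.filter fun e => ∃ o, T o = e).card ≤ K} ≤
      ((1 - z) * Real.exp (-(P * τ)) + z) ^ E.card := by
    refine le_trans (mul_le_mul_of_nonneg_left (measureReal_mono ?_) (by positivity)) hmk
    exact fun T hT => pow_le_pow_of_le_one hz.le hz1 hT
  rw [inv_pow, inv_mul_eq_div, le_div_iff₀ (by positivity), mul_comm]
  exact hmk2.trans (pow_le_pow_left₀ (by positivity) hbase _)

/-! ### Union bound for the failure of robustness -/

/-- Of two disjoint sets that violate `k`-robustness, one contains at most half of the nodes. -/
theorem exists_small_bad_of_not_isKRobust {n k : ℕ} {G : SimpleGraph (Fin n)}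
    (h : ¬ IsKRobust G k) : ∃ A : Finset (Fin n), A.Nonempty ∧ 2 * A.card ≤ n ∧
      ∀ a ∈ A, (G.neighborSet a \ A).encard < k := by
  classical
  unfold IsKRobust at h
  push Not at h
  obtain ⟨A, B, hA, hB, hAB, hbad⟩ := h
  obtain ⟨hA', hB'⟩ := hbad
  have hcard : A.toFinset.card + B.toFinset.card ≤ n := by
    rw [← Finset.card_union_of_disjoint (by simpa using hAB)]
    exact (Finset.card_le_univ _).trans (by simp)
  by_cases hc : 2 * A.toFinset.card ≤ n
  · exact ⟨A.toFinset, by simpa using hA, hc, by simpa using hA'⟩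
  · exact ⟨B.toFinset, by simpa using hB, by omega, by simpa using hB'⟩

theorem setBernoulli_real_pair {n : ℕ} (p : unitInterval) {u v : Fin n} (h : u ≠ v) :
    (setBernoulli (Set.univ : Set (Fin n)) p).real {{u, v}} =
      (p : ℝ) ^ 2 * (1 - p) ^ (n - 2) := by
  rw [setBernoulli_real_singleton p (Set.subset_univ _) Set.finite_univ, Set.ncard_pair h,
    Set.ncard_sdiff (Set.subset_univ _), Set.ncard_pair h, Set.ncard_univ, Nat.card_fin]

open Classical in
/-- The two-element node sets `{a, w}` with `a ∈ A` and `w ∉ A`, as values that the node set of an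
object may take. -/
noncomputable def crossPairs {n : ℕ} (A : Finset (Fin n)) : Finset (Set (Fin n)) :=
  (A ×ˢ Aᶜ).image fun e => {e.1, e.2}

theorem injOn_crossPairs {n : ℕ} (A : Finset (Fin n)) :
    Set.InjOn (fun e : Fin n × Fin n => ({e.1, e.2} : Set (Fin n))) ↑(A ×ˢ Aᶜ) := by
  rintro ⟨a, w⟩ h ⟨a', w'⟩ h' heq
  simp only [Finset.coe_product, Set.mem_prod, Finset.mem_coe, Finset.mem_compl] at h h'
  rcases Set.pair_eq_pair_iff.1 heq with ⟨rfl, rfl⟩ | ⟨rfl, rfl⟩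
  · rfl
  · exact absurd h.1 h'.2

theorem card_crossPairs {n : ℕ} (A : Finset (Fin n)) :
    (crossPairs A).card = A.card * (n - A.card) := by
  classical
  rw [crossPairs, Finset.card_image_of_injOn (injOn_crossPairs A), Finset.card_product,
    Finset.card_compl, Fintype.card_fin]

open Classical in
/-- If no node of `A` has `k` neighbours outside `A`, then at most `(k - 1) * #A` of the pairs
leaving `A` are the exact node set of some object, since every such pair is an edge. -/
theorem card_hit_crossPairs_le {n P k : ℕ} {T : Fin P → Set (Fin n)} {A : Finset (Fin n)}
    (h : ∀ a ∈ A, ((intersectionGraph fun i => {o | i ∈ T o}).neighborSet a \ A).encard < k) :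
    ((crossPairs A).filter fun e => ∃ o, T o = e).card ≤ (k - 1) * A.card := by
  set G := intersectionGraph fun i => {o | i ∈ T o} with hG
  calc ((crossPairs A).filter fun e => ∃ o, T o = e).card
      ≤ (((A ×ˢ Aᶜ).filter fun e => G.Adj e.1 e.2).image
          fun e => ({e.1, e.2} : Set (Fin n))).card := by
        refine Finset.card_le_card fun e he => ?_
        simp only [crossPairs, Finset.mem_filter, Finset.mem_image, Finset.mem_product,
          Finset.mem_compl] at he ⊢
        obtain ⟨⟨x, hx, rfl⟩, o, ho⟩ := he
        refine ⟨x, ⟨hx, fun hxx => hx.2 (hxx ▸ hx.1), o, ?_, ?_⟩, rfl⟩ <;> simp [ho]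
    _ ≤ ((A ×ˢ Aᶜ).filter fun e => G.Adj e.1 e.2).card := Finset.card_image_le
    _ = ∑ a ∈ A, (Aᶜ.filter fun w => G.Adj a w).card := by
        simp only [Finset.card_filter, Finset.sum_product]
    _ ≤ ∑ a ∈ A, (k - 1) := by
        refine Finset.sum_le_sum fun a ha => ?_
        have h1 : G.neighborSet a \ A = ↑(Aᶜ.filter fun w => G.Adj a w) := by
          ext w
          simp [and_comm]
        have h2 := h a ha
        rw [h1, Set.encard_coe_eq_coe_finsetCard] at h2
        have : (Aᶜ.filter fun w => G.Adj a w).card < k := by exact_mod_cast h2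
        omega
    _ = (k - 1) * A.card := by simp [mul_comm]

/-- Union bound over the node sets `A` of size `a ≤ n / 2` without a node having `k` neighbours
outside `A`. Only objects held by exactly two nodes are used; `z` is a free parameter of the
Chernoff bound. -/
theorem one_sub_probKRobust_le (n P k : ℕ) (p : unitInterval) {z : ℝ} (hz : 0 < z) (hz1 : z ≤ 1) :
    1 - probKRobust n P p k ≤ ∑ a ∈ Finset.Icc 1 (n / 2), (n.choose a : ℝ) *
      (z⁻¹ ^ (k - 1) * Real.exp (-((1 - z) *
        (1 - Real.exp (-(P * ((p : ℝ) ^ 2 * (1 - p) ^ (n - 2))))) * (n - a)))) ^ a := by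
  classical
  set ν := setBernoulli (Set.univ : Set (Fin n)) p
  set τ := (p : ℝ) ^ 2 * (1 - p) ^ (n - 2)
  set f : ℕ → ℝ := fun a => (z⁻¹ ^ (k - 1) * Real.exp (-((1 - z) *
        (1 - Real.exp (-(P * τ))) * (n - a)))) ^ a with hf
  rw [probKRobust_eq, ← probReal_compl_eq_one_sub .of_discrete]
  calc _ ≤ (Measure.pi fun _ : Fin P => ν).real
        (⋃ A ∈ (Finset.univ : Finset (Fin n)).powerset.filter
            (fun A => A.card ∈ Finset.Icc 1 (n / 2)),
          {T | ((crossPairs A).filter fun e => ∃ o, T o = e).card ≤ (k - 1) * A.card}) := by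
        refine measureReal_mono (fun T hT => ?_) (measure_ne_top _ _)
        obtain ⟨A, hA, hAn, hbad⟩ := exists_small_bad_of_not_isKRobust hT
        simp only [Set.mem_iUnion]
        refine ⟨A, ?_, card_hit_crossPairs_le hbad⟩
        have := hA.card_pos
        simp only [Finset.mem_filter, Finset.mem_powerset, Finset.mem_Icc, Finset.subset_univ,
          true_and]
        omega
    _ ≤ ∑ A ∈ (Finset.univ : Finset (Fin n)).powerset.filter
            (fun A => A.card ∈ Finset.Icc 1 (n / 2)), f A.card := by
        refine (measureReal_biUnion_finset_le _ _).trans (Finset.sum_le_sum fun A hA => ?_)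
        have hAn : A.card ≤ n := by simpa using Finset.card_le_univ A
        refine (pi_real_card_hit_le ν P (crossPairs A) (τ := τ) ?_ hz hz1 _).trans_eq ?_
        · intro e he
          simp only [crossPairs, Finset.mem_image, Finset.mem_product, Finset.mem_compl] at he
          obtain ⟨x, hx, rfl⟩ := he
          exact setBernoulli_real_pair p fun hxx => hx.2 (hxx ▸ hx.1)
        · simp only [hf]
          rw [card_crossPairs, mul_pow, ← pow_mul, ← Real.exp_nat_mul, ← Real.exp_nat_mul]
          push_cast [hAn]
          ring_nf
    _ = ∑ a ∈ Finset.Icc 1 (n / 2), (n.choose a : ℝ) * f a := by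
        rw [← Finset.sum_fiberwise_of_maps_to (t := Finset.Icc 1 (n / 2)) (g := Finset.card)
          fun A hA => (Finset.mem_filter.1 hA).2]
        refine Finset.sum_congr rfl fun a ha => ?_
        have : ((Finset.univ : Finset (Fin n)).powerset.filter
            (fun A => A.card ∈ Finset.Icc 1 (n / 2))).filter (fun A => A.card = a) =
            Finset.univ.powersetCard a := by
          ext A
          simp only [Finset.mem_filter, Finset.mem_powersetCard, Finset.mem_powerset]
          constructor
          · rintro ⟨⟨h, -⟩, h'⟩
            exact ⟨h, h'⟩
          · rintro ⟨h, h'⟩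
            exact ⟨⟨h, h' ▸ ha⟩, h'⟩
        rw [this, Finset.sum_congr rfl (g := fun _ => f a)
          fun A hA => by rw [(Finset.mem_powersetCard.1 hA).2]]
        simp

/-! ### The second moment method -/

/-- Second moment method: Chebyshev's inequality for the number of the events `B i` that occur. -/
theorem measureReal_iInter_compl_le {Ω I : Type*} [Finite Ω] [MeasurableSpace Ω]
    [DiscreteMeasurableSpace Ω] (μ : Measure Ω) [IsProbabilityMeasure μ] (s : Finset I)
    (B : I → Set Ω) (hM : 0 < ∑ i ∈ s, μ.real (B i)) :
    μ.real {ω | ∀ i ∈ s, ω ∉ B i} ≤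
      (∑ i ∈ s, ∑ j ∈ s, μ.real (B i ∩ B j)) / (∑ i ∈ s, μ.real (B i)) ^ 2 - 1 := by
  set M := ∑ i ∈ s, μ.real (B i) with hMdef
  set X : Ω → ℝ := fun ω => ∑ i ∈ s, (B i).indicator (fun _ => (1 : ℝ)) ω with hX
  have hint (f : Ω → ℝ) : Integrable f μ := .of_finite
  have h1 : ∫ ω, X ω ∂μ = M := by
    rw [hX, integral_finsetSum _ fun _ _ => hint _]
    exact Finset.sum_congr rfl fun i _ => by simp [integral_indicator_const _ .of_discrete]
  have h2 : ∫ ω, X ω ^ 2 ∂μ = ∑ i ∈ s, ∑ j ∈ s, μ.real (B i ∩ B j) := by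
    have (ω : Ω) : X ω ^ 2 =
        ∑ i ∈ s, ∑ j ∈ s, (B i ∩ B j).indicator (fun _ => (1 : ℝ)) ω := by
      rw [sq, hX, Finset.sum_mul_sum]
      refine Finset.sum_congr rfl fun i _ => Finset.sum_congr rfl fun j _ => ?_
      by_cases hi : ω ∈ B i <;> by_cases hj : ω ∈ B j <;> simp [hi, hj]
    simp_rw [this]
    rw [integral_finsetSum _ fun _ _ => hint _]
    refine Finset.sum_congr rfl fun i _ => ?_
    rw [integral_finsetSum _ fun _ _ => hint _]
    exact Finset.sum_congr rfl fun j _ => by simp [integral_indicator_const _ .of_discrete]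
  have h3 : ∫ ω, (X ω - M) ^ 2 ∂μ = ∑ i ∈ s, ∑ j ∈ s, μ.real (B i ∩ B j) - M ^ 2 := by
    have (ω : Ω) : (X ω - M) ^ 2 = X ω ^ 2 - 2 * M * X ω + M ^ 2 := by ring
    simp_rw [this]
    rw [integral_add (hint _) (hint _), integral_sub (hint _) (hint _), integral_const_mul, h1, h2]
    simp
    ring
  have h4 : M ^ 2 * μ.real {ω | ∀ i ∈ s, ω ∉ B i} ≤ ∫ ω, (X ω - M) ^ 2 ∂μ := by
    refine le_trans ?_ (mul_meas_ge_le_integral_of_nonneg (.of_forall fun ω => sq_nonneg _)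
      (hint _) (M ^ 2))
    refine mul_le_mul_of_nonneg_left (measureReal_mono fun ω hω => ?_) (sq_nonneg M)
    have : X ω = 0 := Finset.sum_eq_zero fun i hi => Set.indicator_of_notMem (hω i hi) _
    simp [this]
  rw [h3] at h4
  rw [le_sub_iff_add_le, le_div_iff₀ (by positivity)]
  linarith

/-! ### Nodes of low degree -/

/-- The first `n / 2` nodes. Low-degree nodes are sought only among them, and their edges are
required to lead outside, so that the edges of two such nodes come from disjoint sets of
objects. -/
def lowerHalf (n : ℕ) : Finset (Fin n) := Finset.univ.filter fun v => v.val < n / 2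

theorem card_lowerHalf (n : ℕ) : (lowerHalf n).card = n / 2 := by
  rw [lowerHalf, Fin.card_filter_val_lt, min_eq_right (Nat.div_le_self n 2)]

/-- The node sets that join `v` to exactly one node, lying outside `lowerHalf n`. -/
def outwardPairs {n : ℕ} (v : Fin n) : Set (Set (Fin n)) :=
  {T | ∃ w ∉ lowerHalf n, T = {v, w}}

/-- The node sets that give `v` no neighbour. -/
def harmless {n : ℕ} (v : Fin n) : Set (Set (Fin n)) := {T | v ∈ T → T = {v}}

theorem setBernoulli_real_outwardPairs {n : ℕ} (p : unitInterval) {v : Fin n}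
    (hv : v ∈ lowerHalf n) :
    (setBernoulli (Set.univ : Set (Fin n)) p).real (outwardPairs v) =
      (n - n / 2 : ℕ) * ((p : ℝ) ^ 2 * (1 - p) ^ (n - 2)) := by
  classical
  have hne : ∀ w ∈ (lowerHalf n)ᶜ, v ≠ w := fun w hw h => Finset.mem_compl.1 hw (h ▸ hv)
  have hset : outwardPairs v =
      ↑((lowerHalf n)ᶜ.image fun w => ({v, w} : Set (Fin n))) := by
    ext T
    simp [outwardPairs, eq_comm]
  rw [hset, ← sum_measureReal_singleton, Finset.sum_image, Finset.sum_congr rfl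
    fun w hw => setBernoulli_real_pair p (hne w hw), Finset.sum_const, Finset.card_compl,
    card_lowerHalf, Fintype.card_fin, nsmul_eq_mul]
  intro w hw w' hw' h
  rcases Set.pair_eq_pair_iff.1 h with ⟨-, h⟩ | ⟨h, -⟩
  · exact h
  · exact absurd h (hne w' hw')

theorem setBernoulli_real_harmless {n : ℕ} (p : unitInterval) (v : Fin n) :
    (setBernoulli (Set.univ : Set (Fin n)) p).real (harmless v) =
      1 - p + p * (1 - p) ^ (n - 1) := by
  have h1 := setBernoulli_real_superset p {v}
  have hset : harmless v = {T | ↑({v} : Finset (Fin n)) ⊆ T}ᶜ ∪ {{v}} := by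
    ext T
    simp [harmless, imp_iff_not_or, or_comm]
  rw [hset, measureReal_union _ .of_discrete, measureReal_compl .of_discrete, h1,
    setBernoulli_real_singleton p (Set.subset_univ _) Set.finite_univ,
    Set.ncard_sdiff (Set.subset_univ _), Set.ncard_univ, Nat.card_fin]
  · simp
  · simp

/-- The events of being harmless to `u` and to `v` are almost uncorrelated: the covariance is at
most the probability `p ^ 2` that the set contains both. -/
theorem setBernoulli_real_harmless_inter_le {n : ℕ} (p : unitInterval) {u v : Fin n} (h : u ≠ v) :
    (setBernoulli (Set.univ : Set (Fin n)) p).real (harmless u ∩ harmless v) ≤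
      (1 - p + p * (1 - p) ^ (n - 1)) ^ 2 + (p : ℝ) ^ 2 := by
  set ν := setBernoulli (Set.univ : Set (Fin n)) p
  have h1 := setBernoulli_real_superset p {u, v}
  have hu := setBernoulli_real_harmless p u
  have hv := setBernoulli_real_harmless p v
  have hcap : ν.real ((harmless u)ᶜ ∩ (harmless v)ᶜ) ≤ (p : ℝ) ^ 2 := by
    rw [Finset.card_pair h] at h1
    rw [← h1]
    refine measureReal_mono fun T hT => ?_
    simp only [harmless, Set.mem_inter_iff, Set.mem_compl_iff, Set.mem_ofPred_eq,
      Classical.not_imp] at hT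
    simp [Set.insert_subset_iff, hT.1.1, hT.2.1]
  have hcup := measureReal_union_add_inter (μ := ν) (s := (harmless u)ᶜ) (t := (harmless v)ᶜ)
    .of_discrete
  rw [← Set.compl_inter, measureReal_compl .of_discrete, measureReal_compl .of_discrete,
    measureReal_compl .of_discrete, hu, hv] at hcup
  simp only [probReal_univ] at hcup
  nlinarith [sq_nonneg ((p : ℝ) - p * (1 - p) ^ (n - 1))]

open Classical in
/-- For `i = (v, J)`: the objects in `J` give `v` one neighbour each, outside `lowerHalf n`, and
all other objects give `v` none. The degree of `v` is then at most `#J`. -/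
def lowDegreeEvent {n P : ℕ} (i : Fin n × Finset (Fin P)) : Set (Fin P → Set (Fin n)) :=
  Set.pi Set.univ fun o => if o ∈ i.2 then outwardPairs i.1 else harmless i.1

/-- A node `v` of degree less than `k` violates `k`-robustness through the sets `{v}` and `{v}ᶜ`. -/
theorem not_isKRobust_of_mem_lowDegreeEvent {n P k : ℕ} (hn : 2 ≤ n) {i : Fin n × Finset (Fin P)}
    (hi : i.2.card < k) {T : Fin P → Set (Fin n)} (hT : T ∈ lowDegreeEvent i) :
    ¬ IsKRobust (intersectionGraph fun i => {o | i ∈ T o}) k := by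
  classical
  obtain ⟨v, J⟩ := i
  set G := intersectionGraph fun i => {o | i ∈ T o} with hG
  have hT' : ∀ o, T o ∈ if o ∈ J then outwardPairs v else harmless v := fun o => hT o trivial
  have hdeg : (G.neighborSet v).encard < k := by
    have hsub : ∀ w ∈ G.neighborSet v, ∃ o ∈ J, T o = {v, w} := by
      rintro w ⟨hvw, o, hvo, hwo⟩
      have := hT' o
      split_ifs at this with ho
      · obtain ⟨w', -, hw'⟩ := this
        have hw : w ∈ ({v, w'} : Set (Fin n)) := hw' ▸ hwo
        rcases hw with rfl | hw
        · exact absurd rfl hvw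
        · obtain rfl : w = w' := hw
          exact ⟨o, ho, hw'⟩
      · have hw : w ∈ ({v} : Set (Fin n)) := this hvo ▸ hwo
        exact absurd hw.symm hvw
    have himg : (fun w => ({v, w} : Set (Fin n))) '' G.neighborSet v ⊆ T '' J := by
      rintro _ ⟨w, hw, rfl⟩
      obtain ⟨o, ho, h⟩ := hsub w hw
      exact ⟨o, ho, h⟩
    have hinj : Set.InjOn (fun w => ({v, w} : Set (Fin n))) (G.neighborSet v) := by
      intro w hw w' hw' h
      rcases Set.pair_eq_pair_iff.1 h with ⟨-, h⟩ | ⟨h, -⟩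
      · exact h
      · exact absurd h hw'.1
    calc (G.neighborSet v).encard = _ := (hinj.encard_image).symm
      _ ≤ (T '' J).encard := Set.encard_le_encard himg
      _ ≤ (J : Set (Fin P)).encard := Set.encard_image_le _ _
      _ = J.card := Set.encard_coe_eq_coe_finsetCard J
      _ < k := by exact_mod_cast hi
  intro hrob
  have : Nontrivial (Fin n) := Fin.nontrivial_iff_two_le.2 hn
  obtain ⟨x, hx⟩ := exists_ne v
  -- for `k = 1` the set `{v}ᶜ` could only succeed through an edge to `v`, contradicting degree `0`
  rcases hrob {v} {v}ᶜ ⟨v, rfl⟩ ⟨x, hx⟩ disjoint_compl_right with ⟨a, rfl, ha⟩ | ⟨b, hb, hk⟩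
  · exact absurd (ha.trans (Set.encard_le_encard Set.sdiff_subset)) (not_le.2 hdeg)
  · rw [Set.sdiff_compl] at hk
    by_cases hvb : G.Adj b v
    · -- the only neighbour of `b` outside `B` is `v`, so `k ≤ 1`, and `b` is a neighbour of `v`
      have h1 : (k : ℕ∞) ≤ 1 := hk.trans
        ((Set.encard_le_encard Set.inter_subset_right).trans (Set.encard_singleton v).le)
      have h2 : (1 : ℕ∞) ≤ (G.neighborSet v).encard :=
        Set.one_le_encard_iff_nonempty.2 ⟨b, hvb.symm⟩
      exact absurd (h1.trans h2) (not_le.2 hdeg)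
    · have h1 : G.neighborSet b ∩ {v} = ∅ := by
        ext w
        simp only [Set.mem_inter_iff, SimpleGraph.mem_neighborSet, Set.mem_singleton_iff,
          Set.mem_empty_iff_false, iff_false, not_and]
        rintro h rfl
        exact hvb h
      rw [h1, Set.encard_empty] at hk
      exact absurd (hk.trans zero_le) (not_le.2 hdeg)

theorem pi_real_univ_pi {Ω : Type*} [MeasurableSpace Ω] (ν : Measure Ω) [IsProbabilityMeasure ν]
    {P : ℕ} (C : Fin P → Set Ω) :
    (Measure.pi fun _ : Fin P => ν).real (Set.pi Set.univ C) = ∏ o, ν.real (C o) := by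
  simp [measureReal_def, Measure.pi_pi, ENNReal.toReal_prod]

theorem pi_real_lowDegreeEvent {n P : ℕ} (p : unitInterval) {i : Fin n × Finset (Fin P)}
    (hv : i.1 ∈ lowerHalf n) :
    (Measure.pi fun _ : Fin P => setBernoulli (Set.univ : Set (Fin n)) p).real
      (lowDegreeEvent i) =
      ((n - n / 2 : ℕ) * ((p : ℝ) ^ 2 * (1 - p) ^ (n - 2))) ^ i.2.card *
        (1 - p + p * (1 - p) ^ (n - 1)) ^ (P - i.2.card) := by
  classical
  rw [lowDegreeEvent, pi_real_univ_pi]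
  simp only [apply_ite (setBernoulli (Set.univ : Set (Fin n)) p).real,
    setBernoulli_real_outwardPairs p hv, setBernoulli_real_harmless]
  rw [Finset.prod_ite, Finset.prod_const, Finset.prod_const, Finset.filter_mem_eq_inter,
    Finset.filter_notMem_eq_sdiff, Finset.univ_inter,
    Finset.card_sdiff_of_subset (Finset.subset_univ _), Finset.card_univ, Fintype.card_fin]

theorem outwardPairs_inter_harmless {n : ℕ} {v : Fin n} (hv : v ∈ lowerHalf n) :
    outwardPairs v ∩ harmless v = ∅ := by
  rw [Set.eq_empty_iff_forall_notMem]
  rintro _ ⟨⟨w, hw, rfl⟩, h⟩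
  have : w ∈ ({v} : Set (Fin n)) := h (by simp) ▸ (by simp : w ∈ ({v, w} : Set (Fin n)))
  obtain rfl : w = v := this
  exact hw hv

theorem outwardPairs_inter_outwardPairs {n : ℕ} {u v : Fin n} (hu : u ∈ lowerHalf n)
    (h : u ≠ v) : outwardPairs u ∩ outwardPairs v = ∅ := by
  rw [Set.eq_empty_iff_forall_notMem]
  rintro _ ⟨⟨w, hw, rfl⟩, w', hw', heq⟩
  rcases Set.pair_eq_pair_iff.1 heq with ⟨h', -⟩ | ⟨h', -⟩
  · exact h h'
  · exact hw' (h' ▸ hu)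

theorem lowDegreeEvent_inter_eq_empty {n P : ℕ} {v : Fin n} (hv : v ∈ lowerHalf n)
    {J J' : Finset (Fin P)} (hcard : J.card = J'.card) (hJ : J ≠ J') :
    lowDegreeEvent (v, J) ∩ lowDegreeEvent (v, J') = ∅ := by
  classical
  obtain ⟨o, ho, ho'⟩ : ∃ o ∈ J, o ∉ J' := by
    by_contra! h
    exact hJ (Finset.eq_of_subset_of_card_le h hcard.ge)
  rw [Set.eq_empty_iff_forall_notMem]
  rintro T ⟨h, h'⟩
  have h1 := h o trivial
  have h2 := h' o trivial
  simp only [ho, ho', if_true, if_false] at h1 h2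
  exact (outwardPairs_inter_harmless hv).subset ⟨h1, h2⟩

/-- For `u ≠ v` the joint event forces `J` and `J'` to be disjoint, so this is an inequality between
products over the objects; if `J` meets `J'` the left side is zero. -/
theorem pi_real_lowDegreeEvent_inter_le {n P j : ℕ} (p : unitInterval) {u v : Fin n}
    (hu : u ∈ lowerHalf n) (hv : v ∈ lowerHalf n) (h : u ≠ v) {J J' : Finset (Fin P)}
    (hJ : J.card = j) (hJ' : J'.card = j) :
    (Measure.pi fun _ : Fin P => setBernoulli (Set.univ : Set (Fin n)) p).real
      (lowDegreeEvent (u, J) ∩ lowDegreeEvent (v, J')) ≤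
      ((n - n / 2 : ℕ) * ((p : ℝ) ^ 2 * (1 - p) ^ (n - 2))) ^ (2 * j) *
        ((1 - p + p * (1 - p) ^ (n - 1)) ^ 2 + (p : ℝ) ^ 2) ^ (P - 2 * j) := by
  classical
  set ν := setBernoulli (Set.univ : Set (Fin n)) p
  set d : ℝ := (n - n / 2 : ℕ) * ((p : ℝ) ^ 2 * (1 - p) ^ (n - 2)) with hd
  set ζ : ℝ := (1 - p + p * (1 - p) ^ (n - 1)) ^ 2 + (p : ℝ) ^ 2 with hζ
  have hd0 : 0 ≤ d := by
    have := sub_nonneg.2 p.2.2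
    have := p.2.1
    positivity
  have hζ0 : 0 ≤ ζ := by positivity
  rw [lowDegreeEvent, lowDegreeEvent, ← Set.pi_inter_distrib, pi_real_univ_pi]
  by_cases hdisj : Disjoint J J'
  · calc _ ≤ ∏ o : Fin P, if o ∈ J ∪ J' then d else ζ := by
          refine Finset.prod_le_prod (fun _ _ => measureReal_nonneg) fun o _ => ?_
          have hdu : ν.real (outwardPairs u) = d := setBernoulli_real_outwardPairs p hu
          have hdv : ν.real (outwardPairs v) = d := setBernoulli_real_outwardPairs p hv
          by_cases ho : o ∈ J
          · simp only [ho, if_true, Finset.mem_union, true_or]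
            exact (measureReal_mono Set.inter_subset_left).trans_eq hdu
          · by_cases ho' : o ∈ J'
            · simp only [ho', if_true, Finset.mem_union, or_true]
              exact (measureReal_mono Set.inter_subset_right).trans_eq hdv
            · simp only [ho, ho', if_false, Finset.mem_union, or_self]
              exact setBernoulli_real_harmless_inter_le p h
      _ = _ := by
          rw [Finset.prod_ite, Finset.prod_const, Finset.prod_const, Finset.filter_mem_eq_inter,
            Finset.filter_notMem_eq_sdiff, Finset.univ_inter,
            Finset.card_sdiff_of_subset (Finset.subset_univ _), Finset.card_univ,
            Fintype.card_fin, Finset.card_union_of_disjoint hdisj, hJ, hJ', two_mul]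
  · obtain ⟨o, ho, ho'⟩ := Finset.not_disjoint_iff.1 hdisj
    rw [Finset.prod_eq_zero (Finset.mem_univ o)]
    · positivity
    · simp [ho, ho', outwardPairs_inter_outwardPairs hu h]

/-- Second moment bound; `M` is the expected number of events `lowDegreeEvent (v, J)` with
`#J = k - 1` that occur, `d` and `ζ` are the probabilities that the node set of one object is an
outward pair of `v`, respectively harmless to `v`. -/
theorem probKRobust_le {n P k : ℕ} (hn : 2 ≤ n) (hk : 1 ≤ k) (hP : 2 * (k - 1) ≤ P)
    (p : unitInterval) {d ζ M : ℝ}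
    (hd : d = (n - n / 2 : ℕ) * ((p : ℝ) ^ 2 * (1 - p) ^ (n - 2)))
    (hζ : ζ = 1 - p + p * (1 - p) ^ (n - 1))
    (hM : M = (n / 2 : ℕ) * (P.choose (k - 1)) * (d ^ (k - 1) * ζ ^ (P - (k - 1))))
    (hM0 : 0 < M) (hζ0 : 0 < ζ) :
    probKRobust n P p k ≤ M⁻¹ + ζ⁻¹ ^ (2 * (k - 1)) * Real.exp (P * ((p : ℝ) ^ 2 / ζ ^ 2)) - 1 := by
  classical
  set j := k - 1 with hj
  set μ := Measure.pi fun _ : Fin P => setBernoulli (Set.univ : Set (Fin n)) p with hμ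
  set s := lowerHalf n ×ˢ (Finset.univ : Finset (Fin P)).powersetCard j with hs
  have hmem : ∀ i ∈ s, i.1 ∈ lowerHalf n ∧ i.2.card = j := fun i hi =>
    ⟨(Finset.mem_product.1 hi).1, (Finset.mem_powersetCard.1 (Finset.mem_product.1 hi).2).2⟩
  have hB : ∀ i ∈ s, μ.real (lowDegreeEvent i) = d ^ j * ζ ^ (P - j) := by
    intro i hi
    rw [pi_real_lowDegreeEvent p (hmem i hi).1, (hmem i hi).2, hd, hζ]
  have hcard : (s.card : ℝ) = (n / 2 : ℕ) * (P.choose j) := by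
    rw [hs, Finset.card_product, card_lowerHalf, Finset.card_powersetCard]
    simp
  have hsum : ∑ i ∈ s, μ.real (lowDegreeEvent i) = M := by
    rw [Finset.sum_congr rfl hB, Finset.sum_const, nsmul_eq_mul, hcard, hM]
  have hd0 : 0 ≤ d := by
    have := sub_nonneg.2 p.2.2
    have := p.2.1
    rw [hd]
    positivity
  have hsq : ∑ i ∈ s, ∑ i' ∈ s, μ.real (lowDegreeEvent i ∩ lowDegreeEvent i') ≤
      M + s.card ^ 2 * (d ^ (2 * j) * (ζ ^ 2 + (p : ℝ) ^ 2) ^ (P - 2 * j)) := by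
    have hpair : ∀ i ∈ s, ∀ i' ∈ s, μ.real (lowDegreeEvent i ∩ lowDegreeEvent i') ≤
        (if i = i' then d ^ j * ζ ^ (P - j) else 0) +
          d ^ (2 * j) * (ζ ^ 2 + (p : ℝ) ^ 2) ^ (P - 2 * j) := by
      rintro ⟨u, J⟩ hi ⟨v, J'⟩ hi'
      have hnn : 0 ≤ d ^ (2 * j) * (ζ ^ 2 + (p : ℝ) ^ 2) ^ (P - 2 * j) := by positivity
      obtain ⟨hu, hJ⟩ := hmem _ hi
      obtain ⟨hv, hJ'⟩ := hmem _ hi'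
      split_ifs with heq
      · rw [← heq, Set.inter_self, hB _ hi]
        linarith
      · rw [zero_add]
        by_cases huv : u = v
        · subst huv
          rw [lowDegreeEvent_inter_eq_empty hu (hJ.trans hJ'.symm) fun h => heq (Prod.ext rfl h)]
          simpa using hnn
        · rw [hd, hζ]
          exact pi_real_lowDegreeEvent_inter_le p hu hv huv hJ hJ'
    refine (Finset.sum_le_sum fun i hi => Finset.sum_le_sum (hpair i hi)).trans_eq ?_
    simp only [Finset.sum_add_distrib, Finset.sum_ite_eq, Finset.sum_const, nsmul_eq_mul]
    rw [Finset.sum_congr rfl fun i hi => if_pos hi, ← hsum, Finset.sum_congr rfl hB]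
    ring
  have hmain := measureReal_iInter_compl_le μ s lowDegreeEvent (hsum ▸ hM0)
  rw [hsum] at hmain
  have hcov : probKRobust n P p k ≤ μ.real {ω | ∀ i ∈ s, ω ∉ lowDegreeEvent i} := by
    rw [probKRobust_eq]
    refine measureReal_mono fun T hT i hi hTi => ?_
    exact not_isKRobust_of_mem_lowDegreeEvent hn (by have := (hmem i hi).2; omega) hTi hT
  have hratio : s.card ^ 2 * (d ^ (2 * j) * (ζ ^ 2 + (p : ℝ) ^ 2) ^ (P - 2 * j)) / M ^ 2 ≤
      ζ⁻¹ ^ (2 * j) * Real.exp (P * ((p : ℝ) ^ 2 / ζ ^ 2)) := by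
    -- `M ^ 2` carries the exponent `2 * (P - j)` of `ζ`, the joint events only `2 * (P - 2 * j)`
    have hMsq : M ^ 2 = s.card ^ 2 * d ^ (2 * j) * (ζ ^ 2) ^ (P - 2 * j) * ζ ^ (2 * j) := by
      have : (P - j) * 2 = 2 * (P - 2 * j) + 2 * j := by omega
      rw [hM, hcard, mul_pow, mul_pow (d ^ j), ← pow_mul, ← pow_mul, this, pow_add, ← pow_mul,
        mul_comm j 2]
      ring
    rw [div_le_iff₀ (by positivity), hMsq]
    have hz : ζ ^ 2 + (p : ℝ) ^ 2 = ζ ^ 2 * (1 + (p : ℝ) ^ 2 / ζ ^ 2) := by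
      field_simp
    have hexp : (1 + (p : ℝ) ^ 2 / ζ ^ 2) ^ (P - 2 * j) ≤
        Real.exp (P * ((p : ℝ) ^ 2 / ζ ^ 2)) := by
      rw [Real.exp_nat_mul]
      have h1 : 1 + (p : ℝ) ^ 2 / ζ ^ 2 ≤ Real.exp ((p : ℝ) ^ 2 / ζ ^ 2) := by
        linarith [Real.add_one_le_exp ((p : ℝ) ^ 2 / ζ ^ 2)]
      exact (pow_le_pow_left₀ (by positivity) h1 _).trans
        (pow_le_pow_right₀ (Real.one_le_exp (by positivity)) (Nat.sub_le _ _))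
    calc _ = s.card ^ 2 * d ^ (2 * j) * (ζ ^ 2) ^ (P - 2 * j) *
          (1 + (p : ℝ) ^ 2 / ζ ^ 2) ^ (P - 2 * j) := by
          rw [hz, mul_pow]
          ring
      _ ≤ s.card ^ 2 * d ^ (2 * j) * (ζ ^ 2) ^ (P - 2 * j) *
          Real.exp (P * ((p : ℝ) ^ 2 / ζ ^ 2)) := by gcongr
      _ = _ := by
          rw [inv_pow]
          field_simp
  have hfin : (M + s.card ^ 2 * (d ^ (2 * j) * (ζ ^ 2 + (p : ℝ) ^ 2) ^ (P - 2 * j))) / M ^ 2 ≤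
      M⁻¹ + ζ⁻¹ ^ (2 * j) * Real.exp (P * ((p : ℝ) ^ 2 / ζ ^ 2)) := by
    rw [add_div]
    refine add_le_add (le_of_eq ?_) hratio
    field_simp
  have := div_le_div_of_nonneg_right hsq (sq_nonneg M)
  linarith

/-! ### Explicit bounds in terms of the mean degree -/

theorem sum_Icc_pow_le {x : ℝ} (hx : 0 ≤ x) (hx2 : x ≤ 1 / 2) (m : ℕ) :
    ∑ a ∈ Finset.Icc 1 m, x ^ a ≤ 2 * x * (1 - (1 / 2) ^ m) := by
  induction m with
  | zero => simp
  | succ m ih =>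
    rw [Finset.sum_Icc_succ_top (by omega), pow_succ x, pow_succ (1 / 2 : ℝ)]
    have : x ^ m ≤ (1 / 2) ^ m := pow_le_pow_left₀ hx hx2 m
    nlinarith

theorem choose_le_exp_div_pow (n : ℕ) {a : ℕ} (ha : 1 ≤ a) :
    (n.choose a : ℝ) ≤ (n * Real.exp 1 / a) ^ a := by
  have h1 : (n.choose a : ℝ) ≤ n ^ a / a.factorial := Nat.choose_le_pow_div a n
  have h2 := Real.pow_div_factorial_le_exp (a : ℝ) (by positivity) a
  rw [← Real.exp_one_pow] at h2
  refine h1.trans ?_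
  have ha' : (0 : ℝ) < a := by exact_mod_cast ha
  rw [div_pow, mul_pow, div_le_div_iff₀ (by positivity) (by positivity)]
  rw [div_le_iff₀ (by positivity)] at h2
  calc (n : ℝ) ^ a * a ^ a ≤ n ^ a * (Real.exp 1 ^ a * a.factorial) := by gcongr
    _ = _ := by ring

/-- For `a ≤ n / β` the left side is at most `e`; beyond that it is at most
`exp (β / 2) ≤ n / β ≤ a`. -/
theorem exp_mul_div_le_linear {n a β : ℝ} (ha : 1 ≤ a) (han : 2 * a ≤ n)
    (h : β * Real.exp (β / 2) ≤ n) : Real.exp (β * a / n) ≤ Real.exp 1 * a := by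
  have hn : 0 < n := by linarith
  have he : 1 ≤ Real.exp 1 := Real.one_le_exp zero_le_one
  rcases le_or_gt (β * a) n with h1 | h1
  · have : Real.exp (β * a / n) ≤ Real.exp 1 := Real.exp_le_exp.2 ((div_le_one hn).2 h1)
    nlinarith [Real.exp_pos 1]
  · have hβ : 0 < β := by
      by_contra! h0
      nlinarith
    have h2 : Real.exp (β * a / n) ≤ Real.exp (β / 2) := by
      rw [Real.exp_le_exp, div_le_div_iff₀ hn two_pos]
      nlinarith
    have h3 : Real.exp (β / 2) ≤ a := by
      have : β * Real.exp (β / 2) < β * a := h.trans_lt h1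
      exact (lt_of_mul_lt_mul_left this hβ.le).le
    nlinarith

theorem one_sub_mul_le_pow {p : ℝ} (hp : p ≤ 1) (m : ℕ) : 1 - m * p ≤ (1 - p) ^ m := by
  have := one_add_mul_le_pow (show -2 ≤ -p by linarith) m
  rw [← sub_eq_add_neg] at this
  linarith

/-- With mean degree `B = n * p ^ 2 * P`, the probability that a given pair is the exact node set
of some object is at least `(B - 1) / n` in the Poisson approximation: passing to objects held by
exactly two nodes costs only a bounded shift of `B`, as soon as `n * p` is small compared to
`1 / B`. -/
theorem le_mul_one_sub_exp {n P : ℕ} (p : unitInterval) (hn : 2 ≤ n) {B : ℝ}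
    (hB : B = (p : ℝ) ^ 2 * P * n) (hnp : B * (n * p) ≤ 1 / 2) (hB2 : B ^ 2 ≤ n / 2) :
    B - 1 ≤ n * (1 - Real.exp (-(P * ((p : ℝ) ^ 2 * (1 - p) ^ (n - 2))))) ∧
      n * (1 - Real.exp (-(P * ((p : ℝ) ^ 2 * (1 - p) ^ (n - 2))))) ≤ B := by
  have hp0 := p.2.1
  have hp1 := p.2.2
  have hq : 0 ≤ 1 - (p : ℝ) := sub_nonneg.2 hp1
  have hn0 : (2 : ℝ) ≤ n := by exact_mod_cast hn
  set lam : ℝ := P * ((p : ℝ) ^ 2 * (1 - p) ^ (n - 2)) with hlam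
  have hlam0 : 0 ≤ lam := by positivity
  have hlow : B * (1 - n * p) ≤ n * lam := by
    have h1 : 1 - n * (p : ℝ) ≤ (1 - p) ^ (n - 2) :=
      (one_sub_mul_le_pow hp1 n).trans (pow_le_pow_of_le_one hq (by linarith) (Nat.sub_le _ _))
    have h2 := mul_le_mul_of_nonneg_left h1 (by positivity : 0 ≤ (p : ℝ) ^ 2 * P * n)
    rw [hB, hlam]
    linarith
  have hup : n * lam ≤ B := by
    have h1 : (1 - (p : ℝ)) ^ (n - 2) ≤ 1 := pow_le_one₀ hq (by linarith)
    have h2 := mul_le_mul_of_nonneg_left h1 (by positivity : 0 ≤ (p : ℝ) ^ 2 * P * n)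
    rw [hB, hlam]
    linarith
  have hsq : n * lam ^ 2 ≤ 1 / 2 := by
    have : (n * lam) ^ 2 ≤ n / 2 := (pow_le_pow_left₀ (by positivity) hup 2).trans hB2
    have h3 : n * (n * lam ^ 2) ≤ n * (1 / 2) := by linarith
    exact le_of_mul_le_mul_left h3 (by linarith)
  have hlam1 : lam ≤ 1 := by nlinarith
  have habs := Real.abs_exp_sub_one_sub_id_le (x := -lam)
    (by rwa [abs_neg, abs_of_nonneg hlam0])
  have h4 := (abs_le.1 habs).2
  constructor
  · have : n * (Real.exp (-lam) - 1 - -lam) ≤ n * (-lam) ^ 2 := by gcongr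
    linarith
  · have := mul_le_mul_of_nonneg_left (Real.add_one_le_exp (-lam)) (by positivity : (0 : ℝ) ≤ n)
    linarith

/-- Quantitative form of the positive half; `B - log n - (k - 1) * log (log n)` plays the role of
`α`. With `z = 1 / log n` the sets of size `a` contribute at most `x ^ a`, where `x` is a constant
times `exp (-α)`, and the geometric series is at most `2 * x`. -/
theorem one_sub_probKRobust_le_exp {n P k : ℕ} (p : unitInterval) (hn : 2 ≤ n) (hk : 1 ≤ k)
    {B : ℝ} (hB : B = (p : ℝ) ^ 2 * P * n) (hL : 1 ≤ Real.log n) (hBL : B ≤ 4 / 3 * Real.log n)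
    (hnp : B * (n * p) ≤ 1 / 2) (hB2 : B ^ 2 ≤ n / 2)
    (hexp : 4 / 3 * Real.log n ≤ Real.exp (Real.log n / 3))
    (hx : Real.exp (5 - (B - Real.log n - ((k : ℝ) - 1) * Real.log (Real.log n))) ≤ 1 / 2) :
    1 - probKRobust n P p k ≤
      2 * Real.exp (5 - (B - Real.log n - ((k : ℝ) - 1) * Real.log (Real.log n))) := by
  set L := Real.log n with hLdef
  set x := Real.exp (5 - (B - L - ((k : ℝ) - 1) * Real.log L)) with hxdef
  obtain ⟨hl1, hl2⟩ := le_mul_one_sub_exp p hn hB hnp hB2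
  set l := 1 - Real.exp (-(P * ((p : ℝ) ^ 2 * (1 - p) ^ (n - 2)))) with hl
  have hn0 : (0 : ℝ) < n := by positivity
  have hL0 : 0 < L := by linarith
  refine (one_sub_probKRobust_le n P k p (z := L⁻¹) (by positivity)
    (inv_le_one_of_one_le₀ hL)).trans ?_
  have hterm : ∀ a ∈ Finset.Icc 1 (n / 2), (n.choose a : ℝ) *
      (L⁻¹⁻¹ ^ (k - 1) * Real.exp (-((1 - L⁻¹) * l * (n - a)))) ^ a ≤ x ^ a := by
    intro a ha
    obtain ⟨ha1, ha2⟩ := Finset.mem_Icc.1 ha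
    have ha1' : (1 : ℝ) ≤ a := by exact_mod_cast ha1
    have han : 2 * (a : ℝ) ≤ n := by
      have : 2 * a ≤ n := by omega
      exact_mod_cast this
    have hLk : L ^ (k - 1) = Real.exp (((k : ℝ) - 1) * Real.log L) := by
      rw [← Nat.cast_pred hk, Real.exp_nat_mul, Real.exp_log hL0]
    have hnexp : (n : ℝ) = Real.exp L := (Real.exp_log hn0).symm
    -- the loss from replacing `1 - 1 / L` by `1` is bounded because `n * l = O(L)`
    have hE : Real.exp (-((1 - L⁻¹) * l * (n - a))) ≤
        Real.exp (7 / 3 - B) * Real.exp ((B - 1) * a / n) := by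
      rw [← Real.exp_add, Real.exp_le_exp]
      have h1 : (B - 1) * (n - a) / n ≤ l * (n - a) := by
        rw [div_le_iff₀ hn0]
        nlinarith
      have h2 : L⁻¹ * l * (n - a) ≤ 4 / 3 := by
        rw [mul_assoc, inv_mul_le_iff₀ hL0]
        rcases le_total 0 l with h0 | h0 <;> nlinarith
      have h3 : (B - 1) * (n - a) / n = B - 1 - (B - 1) * a / n := by field_simp
      linarith
    have hlin : Real.exp ((B - 1) * a / n) ≤ Real.exp 1 * a := by
      refine exp_mul_div_le_linear ha1' han ?_
      have h1 : Real.exp ((B - 1) / 2) ≤ Real.exp (2 / 3 * L) := Real.exp_le_exp.2 (by linarith)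
      calc (B - 1) * Real.exp ((B - 1) / 2) ≤ Real.exp (L / 3) * Real.exp (2 / 3 * L) :=
            mul_le_mul (by linarith) h1 (Real.exp_pos _).le (Real.exp_pos _).le
        _ = n := by
            rw [← Real.exp_add, hnexp]
            ring_nf
    calc (n.choose a : ℝ) * (L⁻¹⁻¹ ^ (k - 1) * Real.exp (-((1 - L⁻¹) * l * (n - a)))) ^ a
        ≤ (n * Real.exp 1 / a) ^ a *
          (L ^ (k - 1) * (Real.exp (7 / 3 - B) * (Real.exp 1 * a))) ^ a := by
          rw [inv_inv]
          gcongr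
          · exact choose_le_exp_div_pow n ha1
          · exact hE.trans (by gcongr)
      _ = (Real.exp L * Real.exp 1 * Real.exp (((k : ℝ) - 1) * Real.log L) *
            Real.exp (7 / 3 - B) * Real.exp 1) ^ a := by
          rw [← mul_pow, hLk, ← hnexp]
          congr 1
          field_simp
      _ ≤ x ^ a := by
          simp only [← Real.exp_add]
          refine pow_le_pow_left₀ (Real.exp_pos _).le (Real.exp_le_exp.2 ?_) a
          linarith
  refine (Finset.sum_le_sum hterm).trans ((sum_Icc_pow_le (Real.exp_pos _).le hx _).trans ?_)
  have : (0 : ℝ) ≤ (1 / 2) ^ (n / 2) := by positivity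
  nlinarith [Real.exp_pos (5 - (B - L - ((k : ℝ) - 1) * Real.log L))]

theorem exp_neg_le_one_sub {x : ℝ} (hx : x ≤ 1 / 2) :
    Real.exp (-(x + 2 * x ^ 2)) ≤ 1 - x := by
  have h1 : 0 < 1 - x := by linarith
  rw [← Real.le_log_iff_exp_le h1]
  have h2 := Real.one_sub_inv_le_log_of_pos h1
  have h3 : (1 - x)⁻¹ ≤ 1 + x + 2 * x ^ 2 := by
    rw [inv_le_iff_one_le_mul₀ h1]
    nlinarith [sq_nonneg x]
  linarith

/-- Quantitative form of the negative half; `B - log n - (k - 1) * log (log n)` plays the role of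
`α`. The first summand bounds the inverse of the expected number of low-degree events, the rest
their correlation. -/
theorem probKRobust_le_exp {n P k : ℕ} (p : unitInterval) (hn : 2 ≤ n) (hk : 1 ≤ k)
    (hP : 2 * (k - 1) ≤ P) {B : ℝ} (hB : B = (p : ℝ) ^ 2 * P * n) (hL : 0 < Real.log n)
    (hBL : Real.log n / 2 ≤ B) (hnp : B * (n * p) ≤ 1 / 2) (hnp2 : n * (p : ℝ) ≤ 1 / 2) :
    probKRobust n P p k ≤
      3 * 16 ^ (k - 1) * (k - 1).factorial * Real.exp 1 *
        Real.exp (B - Real.log n - ((k : ℝ) - 1) * Real.log (Real.log n)) +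
      (1 - n * (p : ℝ))⁻¹ ^ (2 * (k - 1)) * Real.exp (4 * (B / n)) - 1 := by
  set j := k - 1 with hj
  set L := Real.log n with hLdef
  have hp0 := p.2.1
  have hp1 := p.2.2
  have hq : 0 ≤ 1 - (p : ℝ) := sub_nonneg.2 hp1
  have hn2 : (2 : ℝ) ≤ n := by exact_mod_cast hn
  have hn0 : (0 : ℝ) < n := by linarith
  set d : ℝ := (n - n / 2 : ℕ) * ((p : ℝ) ^ 2 * (1 - p) ^ (n - 2)) with hd
  set ζ : ℝ := 1 - p + p * (1 - p) ^ (n - 1) with hζ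
  have hx0 : 0 ≤ n * (p : ℝ) ^ 2 := by positivity
  have hxnp : n * (p : ℝ) ^ 2 ≤ n * p := by
    have : (p : ℝ) ^ 2 ≤ p := by nlinarith
    gcongr
  have hζlow : 1 - n * (p : ℝ) ^ 2 ≤ ζ := by
    have h1 : 1 - n * (p : ℝ) ≤ (1 - p) ^ (n - 1) :=
      (one_sub_mul_le_pow hp1 n).trans (pow_le_pow_of_le_one hq (by linarith) (Nat.sub_le _ _))
    nlinarith
  have hζ1 : ζ ≤ 1 := by
    have : (1 - (p : ℝ)) ^ (n - 1) ≤ 1 := pow_le_one₀ hq (by linarith)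
    nlinarith
  have hζhalf : 1 / 2 ≤ ζ := by linarith
  have hζ0 : 0 < ζ := by linarith
  have hdlow : n * (p : ℝ) ^ 2 / 4 ≤ d := by
    have h1 : 1 / 2 ≤ (1 - (p : ℝ)) ^ (n - 2) := le_trans (by linarith)
      ((one_sub_mul_le_pow hp1 n).trans (pow_le_pow_of_le_one hq (by linarith) (Nat.sub_le _ _)))
    have h2 : (n : ℝ) / 2 ≤ (n - n / 2 : ℕ) := by
      have : n ≤ 2 * (n - n / 2) := by omega
      have : (n : ℝ) ≤ 2 * (n - n / 2 : ℕ) := by exact_mod_cast this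
      linarith
    calc n * (p : ℝ) ^ 2 / 4 = n / 2 * ((p : ℝ) ^ 2 * (1 / 2)) := by ring
      _ ≤ d := by rw [hd]; gcongr
  have hchoose : (L / 16) ^ j / j.factorial ≤ P.choose j * d ^ j := by
    have h1 : ((P + 1 - j : ℕ) : ℝ) ^ j / j.factorial ≤ P.choose j := Nat.pow_le_choose j P
    have h2 : (P : ℝ) / 2 ≤ (P + 1 - j : ℕ) := by
      have : P ≤ 2 * (P + 1 - j) := by omega
      have : (P : ℝ) ≤ 2 * (P + 1 - j : ℕ) := by exact_mod_cast this
      linarith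
    calc (L / 16) ^ j / j.factorial ≤ (P / 2 * (n * (p : ℝ) ^ 2 / 4)) ^ j / j.factorial := by
          gcongr
          rw [hB] at hBL
          linarith
      _ = (P / 2 : ℝ) ^ j / j.factorial * (n * (p : ℝ) ^ 2 / 4) ^ j := by
          rw [mul_pow]
          ring
      _ ≤ ((P + 1 - j : ℕ) : ℝ) ^ j / j.factorial * d ^ j := by gcongr
      _ ≤ P.choose j * d ^ j := by
          gcongr
  have hζpow : Real.exp (-B - 1) ≤ ζ ^ (P - j) := by
    have h1 := exp_neg_le_one_sub (hxnp.trans hnp2)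
    have h2 : P * (n * (p : ℝ) ^ 2) = B := by rw [hB]; ring
    have hB0 : 0 ≤ B := by linarith
    calc Real.exp (-B - 1)
        ≤ Real.exp (-(n * (p : ℝ) ^ 2 + 2 * (n * (p : ℝ) ^ 2) ^ 2)) ^ P := by
          rw [← Real.exp_nat_mul, Real.exp_le_exp]
          have h3 : B * (n * (p : ℝ) ^ 2) ≤ 1 / 2 := le_trans (by gcongr) hnp
          have h4 : (P : ℝ) * -(n * (p : ℝ) ^ 2 + 2 * (n * (p : ℝ) ^ 2) ^ 2) =
              -(P * (n * (p : ℝ) ^ 2)) - 2 * ((P * (n * (p : ℝ) ^ 2)) * (n * (p : ℝ) ^ 2)) := by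
            ring
          rw [h4, h2]
          linarith
      _ ≤ ζ ^ P := pow_le_pow_left₀ (Real.exp_pos _).le (h1.trans hζlow) P
      _ ≤ ζ ^ (P - j) := pow_le_pow_of_le_one hζ0.le hζ1 (Nat.sub_le _ _)
  set M : ℝ := (n / 2 : ℕ) * (P.choose j) * (d ^ j * ζ ^ (P - j)) with hM
  have hLk : L ^ j = Real.exp (((k : ℝ) - 1) * Real.log L) := by
    rw [← Nat.cast_pred hk, Real.exp_nat_mul, Real.exp_log hL]
  have hMlow : (3 * 16 ^ j * j.factorial * Real.exp 1 *
      Real.exp (B - L - ((k : ℝ) - 1) * Real.log L))⁻¹ ≤ M := by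
    -- `n / 2` is rounded down, so `n / 3` is the best linear bound valid for `n = 3`
    have h1 : (n : ℝ) / 3 ≤ (n / 2 : ℕ) := by
      have : n ≤ 3 * (n / 2) := by omega
      have : (n : ℝ) ≤ 3 * (n / 2 : ℕ) := by exact_mod_cast this
      linarith
    calc (3 * 16 ^ j * j.factorial * Real.exp 1 *
          Real.exp (B - L - ((k : ℝ) - 1) * Real.log L))⁻¹
        = n / 3 * ((L / 16) ^ j / j.factorial) * Real.exp (-B - 1) := by
          rw [div_pow, hLk, ← Real.exp_log hn0, ← hLdef,
            Real.exp_sub _ (((k : ℝ) - 1) * Real.log L), Real.exp_sub B, Real.exp_sub (-B), Real.exp_neg]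
          field_simp
      _ ≤ (n / 2 : ℕ) * (P.choose j * d ^ j) * ζ ^ (P - j) := by gcongr
      _ = M := by rw [hM]; ring
  have hC0 : 0 < 3 * 16 ^ j * j.factorial * Real.exp 1 *
      Real.exp (B - L - ((k : ℝ) - 1) * Real.log L) := by positivity
  have hM0 : 0 < M := lt_of_lt_of_le (inv_pos.2 hC0) hMlow
  have hmain := probKRobust_le hn hk hP p hd hζ hM hM0 hζ0
  have hMinv : M⁻¹ ≤ 3 * 16 ^ j * j.factorial * Real.exp 1 *
      Real.exp (B - L - ((k : ℝ) - 1) * Real.log L) := inv_le_of_inv_le₀ hC0 hMlow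
  have hrest : ζ⁻¹ ^ (2 * j) * Real.exp (P * ((p : ℝ) ^ 2 / ζ ^ 2)) ≤
      (1 - n * (p : ℝ))⁻¹ ^ (2 * j) * Real.exp (4 * (B / n)) := by
    have h1 : (0 : ℝ) < 1 - n * p := by linarith
    have h2 : (p : ℝ) ^ 2 / ζ ^ 2 ≤ 4 * (p : ℝ) ^ 2 := by
      calc (p : ℝ) ^ 2 / ζ ^ 2 ≤ (p : ℝ) ^ 2 / (1 / 2) ^ 2 := by gcongr
        _ = 4 * (p : ℝ) ^ 2 := by ring
    have h3 : P * ((p : ℝ) ^ 2 / ζ ^ 2) ≤ 4 * (B / n) := by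
      have : 4 * (B / n) = P * (4 * (p : ℝ) ^ 2) := by
        rw [hB]
        field_simp
      rw [this]
      gcongr
    have h4 : ζ⁻¹ ≤ (1 - n * (p : ℝ))⁻¹ := inv_anti₀ h1 (by linarith)
    exact mul_le_mul (pow_le_pow_left₀ (inv_nonneg.2 hζ0.le) h4 _) (Real.exp_le_exp.2 h3)
      (Real.exp_pos _).le (pow_nonneg (inv_nonneg.2 h1.le) _)
  linarith

/-! ### Asymptotics -/

theorem tendsto_log_natCast : Tendsto (fun n : ℕ => Real.log n) atTop atTop :=
  Real.tendsto_log_atTop.comp tendsto_natCast_atTop_atTop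

theorem eventually_log_log_le {ε : ℝ} (hε : 0 < ε) :
    ∀ᶠ n : ℕ in atTop, 0 ≤ Real.log (Real.log n) ∧ Real.log (Real.log n) ≤ ε * Real.log n := by
  have h1 := (Real.isLittleO_log_id_atTop.comp_tendsto tendsto_log_natCast).bound hε
  filter_upwards [h1, tendsto_log_natCast.eventually_ge_atTop 1] with n hn hL
  have h0 := Real.log_nonneg hL
  simp only [Function.comp_apply, id_eq, Real.norm_eq_abs, abs_of_nonneg h0,
    abs_of_nonneg (zero_le_one.trans hL)] at hn
  exact ⟨h0, hn⟩

theorem exists_pool_bound {P : ℕ → ℕ}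
    (hP : (fun n : ℕ => (n : ℝ) * Real.log n ^ 5) =O[atTop] (fun n : ℕ => (P n : ℝ))) :
    ∃ C : ℝ, 0 < C ∧ ∀ᶠ n : ℕ in atTop, n * Real.log n ^ 5 ≤ C * P n := by
  obtain ⟨C, hC, h⟩ := hP.exists_pos
  refine ⟨C, hC, ?_⟩
  filter_upwards [h.bound] with n hn
  rw [Real.norm_eq_abs, Real.norm_eq_abs, Nat.abs_cast] at hn
  exact (le_abs_self _).trans hn

theorem tendsto_pool {P : ℕ → ℕ}
    (hP : (fun n : ℕ => (n : ℝ) * Real.log n ^ 5) =O[atTop] (fun n : ℕ => (P n : ℝ))) :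
    Tendsto P atTop atTop := by
  obtain ⟨C, hC, h⟩ := exists_pool_bound hP
  rw [← tendsto_natCast_atTop_iff (R := ℝ)]
  refine tendsto_atTop_mono' _ ?_ (tendsto_natCast_atTop_atTop.atTop_div_const hC)
  filter_upwards [h, tendsto_log_natCast.eventually_ge_atTop 1] with n hn hL
  rw [div_le_iff₀' hC]
  refine le_trans ?_ hn
  exact le_mul_of_one_le_right (by positivity) (one_le_pow₀ hL)

/-- Any prescribed mean degree `B n` in `[0, 2 * log n]` is eventually attained by some attachment
probability `q n`, and a pool of order at least `n * (log n) ^ 5` makes `n * q n`, the mean number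
of holders of an object, smaller than any multiple of `1 / log n`. -/
theorem exists_attachment {P : ℕ → ℕ}
    (hP : (fun n : ℕ => (n : ℝ) * Real.log n ^ 5) =O[atTop] (fun n : ℕ => (P n : ℝ)))
    {B : ℕ → ℝ} (hB : ∀ᶠ n : ℕ in atTop, 0 ≤ B n ∧ B n ≤ 2 * Real.log n) :
    ∃ q : ℕ → unitInterval, (∀ᶠ n in atTop, (q n : ℝ) ^ 2 * P n * n = B n) ∧
      Tendsto (fun n : ℕ => Real.log n * (n * (q n : ℝ))) atTop (𝓝 0) := by
  obtain ⟨C, hC, hCP⟩ := exists_pool_bound hP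
  set y : ℕ → ℝ := fun n => B n / (n * P n) with hy
  refine ⟨fun n => Set.projIcc 0 1 zero_le_one (√(y n)), ?_⟩
  have hsq : Tendsto (fun n : ℕ => 2 * C / Real.log n ^ 2) atTop (𝓝 0) :=
    Tendsto.const_div_atTop ((tendsto_pow_atTop two_ne_zero).comp tendsto_log_natCast) _
  have key : ∀ᶠ n : ℕ in atTop, 0 ≤ y n ∧ (Real.log n * n) ^ 2 * y n ≤ 2 * C / Real.log n ^ 2 := by
    filter_upwards [hCP, hB, tendsto_log_natCast.eventually_ge_atTop 1,
      (tendsto_pool hP).eventually_gt_atTop 0, eventually_gt_atTop 0] with n h1 h2 hL hP0 hn0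
    have hP0' : (0 : ℝ) < P n := by exact_mod_cast hP0
    have hn0' : (0 : ℝ) < n := by exact_mod_cast hn0
    have hL0 : 0 < Real.log n := by linarith
    refine ⟨div_nonneg h2.1 (by positivity), ?_⟩
    have h3 : (Real.log n * n) ^ 2 * y n = Real.log n ^ 2 * n * B n / P n := by
      rw [hy]
      field_simp
    rw [h3, div_le_div_iff₀ hP0' (by positivity)]
    calc Real.log n ^ 2 * n * B n * Real.log n ^ 2
        ≤ Real.log n ^ 2 * n * (2 * Real.log n) * Real.log n ^ 2 := by
          gcongr
          exact h2.2
      _ = 2 * (n * Real.log n ^ 5) := by ring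
      _ ≤ 2 * C * P n := by linarith
  have hle : ∀ᶠ n : ℕ in atTop, y n ≤ 1 := by
    filter_upwards [key, hsq.eventually_le_const one_pos,
      tendsto_log_natCast.eventually_ge_atTop 1, eventually_ge_atTop 1] with n h1 h2 hL hn
    have hn' : (1 : ℝ) ≤ n := by exact_mod_cast hn
    have h3 : 1 ≤ (Real.log n * n) ^ 2 := one_le_pow₀ (one_le_mul_of_one_le_of_one_le hL hn')
    nlinarith [h1.1, h1.2]
  have hq : ∀ᶠ n : ℕ in atTop, ((Set.projIcc 0 1 zero_le_one (√(y n)) : unitInterval) : ℝ) =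
      √(y n) := by
    filter_upwards [hle] with n h
    rw [Set.projIcc_of_mem _ ⟨Real.sqrt_nonneg _, Real.sqrt_le_one.2 h⟩]
  constructor
  · filter_upwards [hq, key, (tendsto_pool hP).eventually_gt_atTop 0, eventually_gt_atTop 0]
      with n h h1 hP0 hn0
    have hP0' : (P n : ℝ) ≠ 0 := by exact_mod_cast hP0.ne'
    have hn0' : (n : ℝ) ≠ 0 := by exact_mod_cast hn0.ne'
    rw [h, Real.sq_sqrt h1.1, hy]
    field_simp
  · have hroot : Tendsto (fun n : ℕ => √(2 * C / Real.log n ^ 2)) atTop (𝓝 0) := by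
      simpa using hsq.sqrt
    refine squeeze_zero' ?_ ?_ hroot
    · filter_upwards [hq, tendsto_log_natCast.eventually_ge_atTop 1] with n h hL
      rw [h]
      positivity
    · filter_upwards [hq, key, tendsto_log_natCast.eventually_ge_atTop 1] with n h h1 hL
      rw [h, ← mul_assoc]
      refine Real.le_sqrt_of_sq_le ?_
      rw [mul_pow, Real.sq_sqrt h1.1]
      exact h1.2

theorem le_of_sq_mul_le {p q : unitInterval} {c : ℝ} (hc : 0 < c)
    (h : (p : ℝ) ^ 2 * c ≤ (q : ℝ) ^ 2 * c) : p ≤ q :=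
  (pow_le_pow_iff_left₀ p.2.1 q.2.1 two_ne_zero).1 (le_of_mul_le_mul_right h hc)

theorem tendsto_probKRobust_zero {k : ℕ} (hk : 1 ≤ k) {P : ℕ → ℕ} {p : ℕ → unitInterval}
    {α : ℕ → ℝ}
    (hα : ∀ n : ℕ, 2 ≤ n → (p n : ℝ) ^ 2 * (P n : ℝ) * n =
      Real.log n + ((k : ℝ) - 1) * Real.log (Real.log n) + α n)
    (hP : (fun n : ℕ => (n : ℝ) * Real.log n ^ 5) =O[atTop] (fun n : ℕ => (P n : ℝ)))
    (hlim : Tendsto α atTop atBot) :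
    Tendsto (fun n => probKRobust n (P n) (p n) k) atTop (𝓝 0) := by
  have hk' : (1 : ℝ) ≤ k := by exact_mod_cast hk
  -- raise `α` where it is below `-log log n`, so that the mean degree is of order `log n`
  set γ : ℕ → ℝ := fun n => max (α n) (-Real.log (Real.log n)) with hγ
  set B : ℕ → ℝ := fun n => Real.log n + ((k : ℝ) - 1) * Real.log (Real.log n) + γ n with hB
  have hγlim : Tendsto γ atTop atBot := by
    have hll : Tendsto (fun n : ℕ => -Real.log (Real.log n)) atTop atBot :=
      tendsto_neg_atTop_atBot.comp (Real.tendsto_log_atTop.comp tendsto_log_natCast)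
    rw [tendsto_atBot] at hlim hll ⊢
    intro b
    filter_upwards [hlim b, hll b] with n h1 h2 using max_le h1 h2
  have hBbd : ∀ᶠ n : ℕ in atTop, Real.log n / 2 ≤ B n ∧ B n ≤ 2 * Real.log n := by
    filter_upwards [eventually_log_log_le (ε := 1 / (2 * k)) (by positivity),
      hγlim.eventually_le_atBot 0, tendsto_log_natCast.eventually_ge_atTop 1] with n h1 h2 hL
    have h3 : k * Real.log (Real.log n) ≤ Real.log n / 2 := by
      have := mul_le_mul_of_nonneg_left h1.2 (by positivity : (0 : ℝ) ≤ k)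
      have h4 : (k : ℝ) * (1 / (2 * k) * Real.log n) = Real.log n / 2 := by field_simp
      linarith
    have h5 : -Real.log (Real.log n) ≤ γ n := le_max_right _ _
    have h6 := mul_nonneg (sub_nonneg.2 hk') h1.1
    have h7 : Real.log (Real.log n) ≤ k * Real.log (Real.log n) :=
      le_mul_of_one_le_left h1.1 hk'
    simp only [hB]
    constructor <;> linarith
  obtain ⟨q, hq, hqlim⟩ := exists_attachment hP (B := B) (by
    filter_upwards [hBbd, tendsto_log_natCast.eventually_ge_atTop 0] with n h hL
    exact ⟨by linarith, h.2⟩)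
  have hnq : Tendsto (fun n : ℕ => n * (q n : ℝ)) atTop (𝓝 0) := by
    refine squeeze_zero' (.of_forall fun n => mul_nonneg n.cast_nonneg (q n).2.1) ?_ hqlim
    filter_upwards [tendsto_log_natCast.eventually_ge_atTop 1] with n hL
    exact le_mul_of_one_le_left (mul_nonneg n.cast_nonneg (q n).2.1) hL
  have hBn : Tendsto (fun n : ℕ => B n / n) atTop (𝓝 0) := by
    have h1 : Tendsto (fun n : ℕ => 2 * (Real.log n / n)) atTop (𝓝 0) := by
      have := (Real.isLittleO_log_id_atTop.tendsto_div_nhds_zero.comp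
        tendsto_natCast_atTop_atTop).const_mul 2
      simpa using this
    refine squeeze_zero' ?_ ?_ h1
    · filter_upwards [hBbd, tendsto_log_natCast.eventually_ge_atTop 0] with n h hL
      have : 0 ≤ B n := by linarith
      positivity
    · filter_upwards [hBbd] with n h
      rw [← mul_div_assoc]
      gcongr
      exact h.2
  have hbound : Tendsto (fun n : ℕ => 3 * 16 ^ (k - 1) * (k - 1).factorial * Real.exp 1 *
      Real.exp (γ n) + (1 - n * (q n : ℝ))⁻¹ ^ (2 * (k - 1)) * Real.exp (4 * (B n / n)) - 1)
      atTop (𝓝 0) := by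
    have h1 := (Real.tendsto_exp_atBot.comp hγlim).const_mul
      (3 * 16 ^ (k - 1) * (k - 1).factorial * Real.exp 1)
    have h2 := (((tendsto_const_nhds (x := (1 : ℝ))).sub hnq).inv₀ (by norm_num)).pow (2 * (k - 1))
    have h3 := (Real.continuous_exp.tendsto _).comp (hBn.const_mul 4)
    have h4 := (h1.add (h2.mul h3)).sub_const 1
    simpa using h4
  refine squeeze_zero' (.of_forall fun n => measureReal_nonneg) ?_ hbound
  filter_upwards [hq, hBbd, hnq.eventually_le_const (by norm_num : (0 : ℝ) < 1 / 2),
    hqlim.eventually_le_const (by norm_num : (0 : ℝ) < 1 / 4), eventually_ge_atTop 2,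
    tendsto_log_natCast.eventually_ge_atTop 1, (tendsto_pool hP).eventually_ge_atTop (2 * (k - 1)),
    (tendsto_pool hP).eventually_gt_atTop 0] with n h1 h2 h3 h4 hn hL hPk hP0
  have hpq : p n ≤ q n := by
    have hc : (0 : ℝ) < P n * n := by positivity
    refine le_of_sq_mul_le hc ?_
    rw [← mul_assoc, ← mul_assoc, hα n hn, h1]
    simp only [hB]
    linarith [le_max_left (α n) (-Real.log (Real.log n))]
  refine (probKRobust_mono hpq).trans ?_
  have hnq0 : 0 ≤ n * (q n : ℝ) := mul_nonneg n.cast_nonneg (q n).2.1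
  have := probKRobust_le_exp (q n) hn hk hPk h1.symm (by linarith) h2.1 (by nlinarith [h2.2]) h3
  have hγB : B n - Real.log n - ((k : ℝ) - 1) * Real.log (Real.log n) = γ n := by
    simp only [hB]
    ring
  rwa [hγB] at this

theorem tendsto_probKRobust_one {k : ℕ} (hk : 1 ≤ k) {P : ℕ → ℕ} {p : ℕ → unitInterval}
    {α : ℕ → ℝ}
    (hα : ∀ n : ℕ, 2 ≤ n → (p n : ℝ) ^ 2 * (P n : ℝ) * n =
      Real.log n + ((k : ℝ) - 1) * Real.log (Real.log n) + α n)
    (hP : (fun n : ℕ => (n : ℝ) * Real.log n ^ 5) =O[atTop] (fun n : ℕ => (P n : ℝ)))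
    (hlim : Tendsto α atTop atTop) :
    Tendsto (fun n => probKRobust n (P n) (p n) k) atTop (𝓝 1) := by
  have hk' : (1 : ℝ) ≤ k := by exact_mod_cast hk
  -- lower `α` where it is above `log log n`, so that the mean degree is of order `log n`
  set γ : ℕ → ℝ := fun n => min (α n) (Real.log (Real.log n)) with hγ
  set B : ℕ → ℝ := fun n => Real.log n + ((k : ℝ) - 1) * Real.log (Real.log n) + γ n with hB
  have hγlim : Tendsto γ atTop atTop := by
    have hll : Tendsto (fun n : ℕ => Real.log (Real.log n)) atTop atTop :=
      Real.tendsto_log_atTop.comp tendsto_log_natCast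
    rw [tendsto_atTop] at hlim hll ⊢
    intro b
    filter_upwards [hlim b, hll b] with n h1 h2 using le_min h1 h2
  have hBbd : ∀ᶠ n : ℕ in atTop, 0 ≤ B n ∧ B n ≤ 4 / 3 * Real.log n := by
    filter_upwards [eventually_log_log_le (ε := 1 / (3 * k)) (by positivity),
      hγlim.eventually_ge_atTop 0, tendsto_log_natCast.eventually_ge_atTop 1] with n h1 h2 hL
    have h3 : k * Real.log (Real.log n) ≤ Real.log n / 3 := by
      have := mul_le_mul_of_nonneg_left h1.2 (by positivity : (0 : ℝ) ≤ k)
      have h4 : (k : ℝ) * (1 / (3 * k) * Real.log n) = Real.log n / 3 := by field_simp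
      linarith
    have h5 : γ n ≤ Real.log (Real.log n) := min_le_right _ _
    have h6 := mul_nonneg (sub_nonneg.2 hk') h1.1
    simp only [hB]
    constructor <;> linarith
  obtain ⟨q, hq, hqlim⟩ := exists_attachment hP (B := B) (by
    filter_upwards [hBbd, tendsto_log_natCast.eventually_ge_atTop 0] with n h hL
    exact ⟨h.1, by linarith [h.2]⟩)
  have hx : Tendsto (fun n => Real.exp (5 - γ n)) atTop (𝓝 0) :=
    Real.tendsto_exp_atBot.comp (tendsto_atBot_add_const_left _ 5
      (tendsto_neg_atTop_atBot.comp hγlim))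
  have hlog2 : ∀ᶠ n : ℕ in atTop, Real.log n ^ 2 ≤ 1 / 4 * n := by
    have h1 := (Real.isLittleO_pow_log_id_atTop (n := 2)).comp_tendsto
      (tendsto_natCast_atTop_atTop (R := ℝ))
    filter_upwards [h1.bound (by norm_num : (0 : ℝ) < 1 / 4)] with n hn
    simpa using hn
  have hlow : Tendsto (fun n => 1 - 2 * Real.exp (5 - γ n)) atTop (𝓝 1) := by
    simpa using (hx.const_mul 2).const_sub 1
  refine tendsto_of_tendsto_of_tendsto_of_le_of_le' hlow tendsto_const_nhds ?_
    (.of_forall fun n => ?_)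
  · filter_upwards [hq, hBbd, hx.eventually_le_const (by norm_num : (0 : ℝ) < 1 / 2),
      hqlim.eventually_le_const (by norm_num : (0 : ℝ) < 1 / 4), eventually_ge_atTop 2,
      tendsto_log_natCast.eventually_ge_atTop 24, (tendsto_pool hP).eventually_gt_atTop 0, hlog2]
      with n h1 h2 h3 h4 hn hL hP0 h5
    have hqp : q n ≤ p n := by
      have hc : (0 : ℝ) < P n * n := by positivity
      refine le_of_sq_mul_le hc ?_
      rw [← mul_assoc, ← mul_assoc, hα n hn, h1]
      simp only [hB]
      linarith [min_le_left (α n) (Real.log (Real.log n))]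
    have hγB : B n - Real.log n - ((k : ℝ) - 1) * Real.log (Real.log n) = γ n := by
      simp only [hB]
      ring
    have hnq0 : 0 ≤ n * (q n : ℝ) := mul_nonneg n.cast_nonneg (q n).2.1
    have hexp : 4 / 3 * Real.log n ≤ Real.exp (Real.log n / 3) := by
      have := Real.quadratic_le_exp_of_nonneg (x := Real.log n / 3) (by linarith)
      nlinarith
    have := one_sub_probKRobust_le_exp (q n) hn hk h1.symm (by linarith) h2.2
      (by nlinarith [h2.2]) (by nlinarith [h2.1, h2.2]) hexp (by rwa [hγB])
    rw [hγB] at this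
    linarith [probKRobust_mono (n := n) (P := P n) (k := k) hqp]
  · have : IsProbabilityMeasure (binomialObjectSets n (P n) (p n)) := by
      unfold binomialObjectSets
      infer_instance
    exact measureReal_le_one

theorem theorem4 (k : ℕ) (hk : 1 ≤ k) (P : ℕ → ℕ) (p : ℕ → unitInterval) (α : ℕ → ℝ)
    (hα : ∀ n : ℕ, 2 ≤ n →
      (p n : ℝ) ^ 2 * (P n : ℝ) =
        (Real.log n + ((k : ℝ) - 1) * Real.log (Real.log n) + α n) / n)
    (hP : (fun n : ℕ => (n : ℝ) * Real.log n ^ 5) =O[atTop] (fun n : ℕ => (P n : ℝ))) :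
    (Tendsto α atTop atBot → Tendsto (fun n => probKRobust n (P n) (p n) k) atTop (𝓝 0)) ∧
    (Tendsto α atTop atTop → Tendsto (fun n => probKRobust n (P n) (p n) k) atTop (𝓝 1)) := by
  have hα' : ∀ n : ℕ, 2 ≤ n → (p n : ℝ) ^ 2 * (P n : ℝ) * n =
      Real.log n + ((k : ℝ) - 1) * Real.log (Real.log n) + α n := by
    intro n hn
    have hn0 : (n : ℝ) ≠ 0 := by positivity
    rw [hα n hn, div_mul_cancel₀ _ hn0]
  exact ⟨tendsto_probKRobust_zero hk hα' hP, tendsto_probKRobust_one hk hα' hP⟩
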